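/- Let $\Bbbk$ be a field, let $n\ge 1$ and $r_1,\dots,r_n\ge 2$ be integers, and let $s,t\in\{1,\dots,n\}$. Put $\mathcal N=[r_1]\times\cdots\times[r_n]$, where $[m]=\{1,\dots,m\}$. Two indices $a,b\in\mathcal N$ are called $s$-equivalent if $\sum_{i=1}^s a_i=\sum_{i=1}^s b_i$ and $a_i=b_i$ for all $i>s$. Let $R=\Bbbk[x_a : a\in\mathcal N]$ be the polynomial ring in which the variables $x_a$ and $x_b$ are identified if and only if $a$ and $b$ are $s$-equivalent (so there is one variable for each $s$-equivalence class). For $a,b\in\mathcal N$ and $i\in[n]$ let $\mathrm{sw}(i,a,b)$ be the index obtained from $a$ by replacing its $i$th component by $b_i$, let $\mathrm d(a,b)=\#\{i: a_i\ne b_i\}$, and put $$f_{i,a,b}=x_ax_b-x_{\mathrm{sw}(i,a,b)}\,x_{\mathrm{sw}(i,b,a)}\in R .$$ The slice-minor ideal is $I^{\langle s,t\rangle}=(f_{i,a,b} : a,b\in\mathcal N,\ \mathrm d(a,b)=2,\ i\in[t])$. A subset $\mathcal S\subseteq\mathcal N$ (possibly empty) is $(s,t)$-switchable if (1) $\mathrm{sw}(i,a,b)\in\mathcal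 S$ for all $a,b\in\mathcal S$ with $\mathrm d(a,b)=2$ and all $i\in[t]$, and (2) every index that is $s$-equivalent to an element of $\mathcal S$ lies in $\mathcal S$. Two elements $a,b\in\mathcal S$ are connected in $\mathcal S$ if there are $c_0=a,c_1,\dots,c_k=b$ in $\mathcal S$ ($k\ge 0$) with $\mathrm d(c_{j-1},c_j)=1$ for all $j\in[k]$. For an $(s,t)$-switchable set $\mathcal S$ let $$P_{\mathcal S}=(x_a : a\in \mathcal N\setminus\mathcal S)+(f_{i,a,b} : i\in[t],\ a,b \text{ connected in }\mathcal S)\subseteq R .$$ An $(s,t)$-switchable set $\mathcal S$ is maximal $(s,t)$-switchable if for every $(s,t)$-switchable set $\mathcal T\supsetneq\mathcal S$ the ideals $P_{\mathcal S}$ and $P_{\mathcal T}$ are incomparable, i.e. neither contains the other. **Theorem.** The set of minimal primes over $I^{\langle s,t\rangle}$ is exactly the set of ideals $P_{\mathcal S}$, where $\mathcal S$ ranges over the maximal $(s,t)$-switchable sets. -/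

import Mathlib

namespace HankelHypermatrix

/-- The set of indices `[r₁] × ⋯ × [rₙ]`. Components are numbered from `0`, both the positions
(`Fin n`) and the values (`Fin (r i)`). -/
abbrev Index {n : ℕ} (r : Fin n → ℕ) : Type := (i : Fin n) → Fin (r i)

variable {n : ℕ} {r : Fin n → ℕ}

/-- Two indices are `s`-equivalent if their first `s` components have the same sum and all the
other components agree. -/
def SEquiv (s : ℕ) (a b : Index r) : Prop :=
  (∑ i with i.val < s, (a i).val) = (∑ i with i.val < s, (b i).val) ∧
    ∀ i : Fin n, s ≤ i.val → a i = b i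

/-- `s`-equivalence as an equivalence relation. -/
def sSetoid (r : Fin n → ℕ) (s : ℕ) : Setoid (Index r) where
  r := SEquiv s
  iseqv :=
    { refl := fun _ => ⟨rfl, fun _ _ => rfl⟩
      symm := fun h => ⟨h.1.symm, fun i hi => (h.2 i hi).symm⟩
      trans := fun h k => ⟨h.1.trans k.1, fun i hi => (h.2 i hi).trans (k.2 i hi)⟩ }

/-- The polynomial ring `R = K[x_a : a ∈ N]`, with one variable for each `s`-equivalence class. -/
abbrev Ring (K : Type*) [Field K] (r : Fin n → ℕ) (s : ℕ) : Type _ :=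
  MvPolynomial (Quotient (sSetoid r s)) K

/-- The variable `x_a`, the entry of the `s`-Hankel hypermatrix in position `a`. -/
noncomputable def x (K : Type*) [Field K] (s : ℕ) (a : Index r) : Ring K r s :=
  MvPolynomial.X (Quotient.mk (sSetoid r s) a)

/-- The switch `sw(i, a, b)`: the `i`-th component of `a` is replaced by that of `b`. -/
def sw (i : Fin n) (a b : Index r) : Index r := Function.update a i (b i)

/-- The generalized minor `f_{i,a,b} = x_a x_b - x_{sw(i,a,b)} x_{sw(i,b,a)}`. -/
noncomputable def minor (K : Type*) [Field K] (s : ℕ) (i : Fin n) (a b : Index r) : Ring K r s :=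
  x K s a * x K s b - x K s (sw i a b) * x K s (sw i b a)

/-- The ideal `I^{(s,t)}` generated by the slice minors `f_{i,a,b}`, where `a`, `b` have Hamming
distance two and `i` is one of the first `t` positions. -/
noncomputable def sliceIdeal (K : Type*) [Field K] (r : Fin n → ℕ) (s t : ℕ) : Ideal (Ring K r s) :=
  Ideal.span {f | ∃ (i : Fin n) (a b : Index r),
    i.val < t ∧ hammingDist a b = 2 ∧ f = minor K s i a b}

/-- `(s,t)`-switchable sets of indices. -/
structure IsSwitchable (s t : ℕ) (S : Set (Index r)) : Prop where
  sw_mem : ∀ a ∈ S, ∀ b ∈ S, hammingDist a b = 2 → ∀ i : Fin n, i.val < t → sw i a b ∈ S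
  mem_of_sEquiv : ∀ a ∈ S, ∀ b : Index r, SEquiv s b a → b ∈ S

/-- Two elements of `S` are connected in `S` if they are joined by a finite sequence of elements
of `S` in which consecutive elements have Hamming distance one. -/
def Connected (S : Set (Index r)) (a b : Index r) : Prop :=
  a ∈ S ∧ b ∈ S ∧
    Relation.ReflTransGen (fun c d => c ∈ S ∧ d ∈ S ∧ hammingDist c d = 1) a b

/-- The ideal generated by the minors `f_{i,a,b}` with `i` among the first `t` positions and `a`,
`b` connected in `S`. -/
noncomputable def connectedIdeal (K : Type*) [Field K] (s t : ℕ) (S : Set (Index r)) : Ideal (Ring K r s) :=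
  Ideal.span {f | ∃ (i : Fin n) (a b : Index r),
    i.val < t ∧ Connected S a b ∧ f = minor K s i a b}

/-- The ideal generated by the variables `x_a` with `a ∉ S`. -/
noncomputable def varIdeal (K : Type*) [Field K] (s : ℕ) (S : Set (Index r)) : Ideal (Ring K r s) :=
  Ideal.span {f | ∃ a : Index r, a ∉ S ∧ f = x K s a}

/-- The ideal `P_S`. -/
noncomputable def P (K : Type*) [Field K] (s t : ℕ) (S : Set (Index r)) : Ideal (Ring K r s) :=
  varIdeal K s S + connectedIdeal K s t S

/-- An `(s,t)`-switchable set `S` is maximal `(s,t)`-switchable if for every `(s,t)`-switchable set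
`T` that properly contains `S` the ideals `P_S` and `P_T` are incomparable. -/
def IsMaximalSwitchable (K : Type*) [Field K] (s t : ℕ) (S : Set (Index r)) : Prop :=
  IsSwitchable s t S ∧
    ∀ T : Set (Index r), IsSwitchable s t T → S ⊂ T →
      ¬ P K s t S ≤ P K s t T ∧ ¬ P K s t T ≤ P K s t S

end HankelHypermatrix

namespace HankelHypermatrix

variable {n : ℕ} {r : Fin n → ℕ} {s t : ℕ} {S : Set (Index r)} {a b c d : Index r} {i j : Fin n}

/-! Two facts carry the theorem. For switchable `S` the ideal `P K s t S` is a prime over the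
slice-minor ideal (`P_isPrime`, `sliceIdeal_le_P`). Conversely, a prime `Q` over the slice-minor
ideal has switchable `support Q` and contains `P K s t (support Q)` (`P_support_le`). So the minimal
primes are the minimal members of the family of all `P K s t S`. Since `x K s a` lies in this ideal
only if `a ∉ S`, an inclusion of two such ideals reverses the inclusion of the sets, and minimality
becomes the stated maximality.

Primality comes from a toric parametrization with kernel `P K s t S` (`ker_toricMap`). The image of
a variable records its connected component, the entries no move can change, the switchable entries
outside the Hankel block, and the sum over the block. It is well defined because `s`-equivalent
elements of `S` are connected: the first position is both in the block and switchable. For the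
kernel, monomials of equal weight must be congruent modulo `P K s t S` (`cong_of_monWeight_eq`). One
factor at a time is matched: switches repair single entries, and unit shifts of the block sum
between two factors (`exists_shift`) repair the sum. -/

/-! ### Hamming distance and switches. -/

lemma hammingDist_eq_one_of (hi : a i ≠ b i) (h : ∀ k, k ≠ i → a k = b k) :
    hammingDist a b = 1 := by
  rw [hammingDist, Finset.card_eq_one]
  refine ⟨i, ?_⟩
  ext k
  simp only [Finset.mem_filter, Finset.mem_univ, true_and, Finset.mem_singleton]
  exact ⟨fun hk => by_contra fun hki => hk (h k hki), fun hk => hk ▸ hi⟩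

lemma hammingDist_eq_two_of (hij : i ≠ j) (hi : a i ≠ b i) (hj : a j ≠ b j)
    (h : ∀ k, k ≠ i → k ≠ j → a k = b k) : hammingDist a b = 2 := by
  rw [hammingDist, Finset.card_eq_two]
  refine ⟨i, j, hij, ?_⟩
  ext k
  simp only [Finset.mem_filter, Finset.mem_univ, true_and, Finset.mem_insert,
    Finset.mem_singleton]
  refine ⟨fun hk => ?_, ?_⟩
  · by_contra hc
    push Not at hc
    obtain ⟨h1, h2⟩ := hc
    exact hk (h k h1 h2)
  · rintro (rfl | rfl) <;> assumption

lemma exists_of_hammingDist_eq_one (h : hammingDist a b = 1) :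
    ∃ j, a j ≠ b j ∧ ∀ k, k ≠ j → a k = b k := by
  rw [hammingDist, Finset.card_eq_one] at h
  obtain ⟨j, hj⟩ := h
  have key : ∀ k, a k ≠ b k ↔ k = j := fun k => by
    simpa using Finset.ext_iff.1 hj k
  exact ⟨j, (key j).2 rfl, fun k hk => by_contra fun hc => hk ((key k).1 hc)⟩

lemma exists_of_hammingDist_eq_two (h : hammingDist a b = 2) (hi : a i ≠ b i) :
    ∃ j, j ≠ i ∧ a j ≠ b j ∧ ∀ k, k ≠ i → k ≠ j → a k = b k := by
  rw [hammingDist, Finset.card_eq_two] at h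
  obtain ⟨p, q, hpq, hj⟩ := h
  have key : ∀ k, a k ≠ b k ↔ k = p ∨ k = q := fun k => by
    simpa using Finset.ext_iff.1 hj k
  have hk : ∀ k, k ≠ p → k ≠ q → a k = b k := fun k h1 h2 =>
    by_contra fun hc => ((key k).1 hc).elim h1 h2
  rcases (key i).1 hi with rfl | rfl
  · exact ⟨q, hpq.symm, (key q).2 (Or.inr rfl), hk⟩
  · exact ⟨p, hpq, (key p).2 (Or.inl rfl), fun k h1 h2 => hk k h2 h1⟩

@[simp] lemma sw_self_pos (i : Fin n) (a b : Index r) : sw i a b i = b i := by simp [sw]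

@[simp] lemma sw_of_ne (hij : j ≠ i) (a b : Index r) : sw i a b j = a j := by simp [sw, hij]

lemma sw_eq_self (h : a i = b i) : sw i a b = a := by simp [sw, ← h]

@[simp] lemma sw_sw_sw (i : Fin n) (a b : Index r) : sw i (sw i a b) (sw i b a) = a := by
  simp [sw]

/-! ### Connectedness -/

lemma Connected.refl (ha : a ∈ S) : Connected S a a := ⟨ha, ha, .refl⟩

lemma Connected.symm (h : Connected S a b) : Connected S b a :=
  have : Std.Symm fun c d : Index r => c ∈ S ∧ d ∈ S ∧ hammingDist c d = 1 :=
    ⟨fun _ _ h => ⟨h.2.1, h.1, by rw [hammingDist_comm]; exact h.2.2⟩⟩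
  ⟨h.2.1, h.1, Relation.ReflTransGen.stdSymm.symm _ _ h.2.2⟩

lemma Connected.trans (h : Connected S a b) (h' : Connected S b c) : Connected S a c :=
  ⟨h.1, h'.2.1, h.2.2.trans h'.2.2⟩

lemma connected_of_forall_ne (ha : a ∈ S) (hb : b ∈ S) (h : ∀ k, k ≠ i → a k = b k) :
    Connected S a b := by
  by_cases hi : a i = b i
  · have : a = b := funext fun k => by
      by_cases hk : k = i
      · exact hk ▸ hi
      · exact h k hk
    exact this ▸ .refl ha
  · exact ⟨ha, hb, .single ⟨ha, hb, hammingDist_eq_one_of hi h⟩⟩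

/-- If `c` and `d` differ at `j ≠ i`, then `d` and the updated `c` differ exactly at `i` and `j`
(unless `v = d i`), so switchability applies to them. Iterated along a path, this extends the
closure from distance two to connected pairs. -/
lemma IsSwitchable.update_mem_of_dist_one (hS : IsSwitchable s t S) (hi : i.val < t)
    (hd : d ∈ S) (hcd : hammingDist c d = 1) {v : Fin (r i)}
    (hv : Function.update c i v ∈ S) : Function.update d i v ∈ S := by
  obtain ⟨j, hj, hk⟩ := exists_of_hammingDist_eq_one hcd
  by_cases hij : j = i
  · subst hij
    have : Function.update d j v = Function.update c j v := by
      funext k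
      by_cases hkj : k = j
      · subst hkj; simp
      · simp [hkj, hk k hkj]
    rwa [this]
  · by_cases hvi : v = d i
    · subst hvi; simpa using hd
    · have h2 : hammingDist d (Function.update c i v) = 2 := by
        refine hammingDist_eq_two_of (i := i) (j := j) (Ne.symm hij) ?_ ?_ ?_
        · simpa using Ne.symm hvi
        · simpa [hij] using hj.symm
        · intro k h1 h2
          simpa [h1] using (hk k h2).symm
      simpa [sw] using hS.sw_mem d hd _ hv h2 i hi

lemma IsSwitchable.update_mem (hS : IsSwitchable s t S) (hi : i.val < t)
    (h : Connected S a b) {v : Fin (r i)} (hv : Function.update a i v ∈ S) :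
    Function.update b i v ∈ S := by
  obtain ⟨-, -, h⟩ := h
  induction h with
  | refl => exact hv
  | tail _ hcd ih => exact hS.update_mem_of_dist_one hi hcd.2.1 hcd.2.2 ih

lemma IsSwitchable.sw_mem_of_connected (hS : IsSwitchable s t S) (hi : i.val < t)
    (h : Connected S a b) : sw i a b ∈ S :=
  hS.update_mem hi h.symm (by simpa using h.2.1)

lemma IsSwitchable.connected_sw (hS : IsSwitchable s t S) (hi : i.val < t)
    (h : Connected S a b) : Connected S a (sw i a b) :=
  connected_of_forall_ne (i := i) h.1 (hS.sw_mem_of_connected hi h) fun k hk => by simp [hk]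

/-! ### Block sums and unit moves -/

/-- The sum of the first `s` components of an index. -/
def blockSum (s : ℕ) (a : Index r) : ℕ := ∑ i with i.val < s, (a i).val

/-- The largest possible value of `blockSum`. -/
def maxBlockSum (r : Fin n → ℕ) (s : ℕ) : ℕ := ∑ i : Fin n with i.val < s, (r i - 1)

lemma sEquiv_iff : SEquiv s a b ↔
    blockSum s a = blockSum s b ∧ ∀ i : Fin n, s ≤ i.val → a i = b i := Iff.rfl

lemma blockSum_le (a : Index r) : blockSum s a ≤ maxBlockSum r s :=
  Finset.sum_le_sum fun i _ => by have := (a i).isLt; omega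

lemma blockSum_of_forall_ne (hi : i.val < s) (h : ∀ k, k ≠ i → a k = b k) :
    blockSum s a + b i = blockSum s b + a i := by
  have hm : i ∈ Finset.univ.filter (fun i : Fin n => i.val < s) := by simpa using hi
  rw [blockSum, blockSum, ← Finset.add_sum_erase _ _ hm, ← Finset.add_sum_erase _ _ hm,
    Finset.sum_congr rfl fun k hk => by rw [h k (Finset.ne_of_mem_erase hk)]]
  ring

lemma blockSum_congr (h : ∀ k : Fin n, k.val < s → a k = b k) : blockSum s a = blockSum s b :=
  Finset.sum_congr rfl fun k hk => by rw [h k (by simpa using hk)]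

lemma blockSum_sw_add (i : Fin n) (a b : Index r) :
    blockSum s (sw i a b) + blockSum s (sw i b a) = blockSum s a + blockSum s b := by
  by_cases hi : i.val < s
  · have h1 := blockSum_of_forall_ne (a := sw i a b) (b := a) hi fun k hk => by simp [hk]
    have h2 := blockSum_of_forall_ne (a := sw i b a) (b := b) hi fun k hk => by simp [hk]
    simp only [sw_self_pos] at h1 h2
    omega
  · have key : ∀ a b : Index r, blockSum s (sw i a b) = blockSum s a := fun a b =>
      blockSum_congr fun k hk => by
        have : k ≠ i := by rintro rfl; exact hi hk
        simp [this]
    rw [key, key]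

/-- `b` arises from `a` by raising component `p` and lowering component `q` by one. -/
structure UnitMove (p q : Fin n) (a b : Index r) : Prop where
  ne : p ≠ q
  up : (b p).val = a p + 1
  down : (a q).val = b q + 1
  off : ∀ k, k ≠ p → k ≠ q → a k = b k

lemma exists_unitMove {p q : Fin n} (hpq : p ≠ q) (hp : (a p).val + 1 < r p)
    (hq : 0 < (a q).val) : ∃ b, UnitMove p q a b := by
  refine ⟨Function.update (Function.update a p ⟨a p + 1, hp⟩) q
    ⟨a q - 1, by have := (a q).isLt; omega⟩, hpq, ?_, ?_, ?_⟩
  · simp [hpq]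
  · simp; omega
  · intro k h1 h2
    simp [h1, h2]

lemma UnitMove.sEquiv {p q : Fin n} (h : UnitMove p q a b) (hp : p.val < s) (hq : q.val < s) :
    SEquiv s a b := by
  refine ⟨?_, fun k hk => h.off k (by rintro rfl; omega) (by rintro rfl; omega)⟩
  have h1 := blockSum_of_forall_ne (a := a) (b := sw p a b) hp fun k hk => by simp [hk]
  have h2 := blockSum_of_forall_ne (a := sw p a b) (b := b) hq fun k hk => by
    by_cases hkp : k = p
    · subst hkp; simp
    · simp [hkp, h.off k hkp hk]
  rw [sw_self_pos] at h1
  rw [sw_of_ne h.ne.symm] at h2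
  have := h.up
  have := h.down
  change blockSum s a = blockSum s b
  omega

lemma SEquiv.symm (h : SEquiv s a b) : SEquiv s b a := (sSetoid r s).symm h

lemma SEquiv.trans (h : SEquiv s a b) (h' : SEquiv s b c) : SEquiv s a c :=
  (sSetoid r s).trans h h'

lemma IsSwitchable.mem_of_sEquiv' (hS : IsSwitchable s t S) (ha : a ∈ S) (h : SEquiv s a b) :
    b ∈ S := hS.mem_of_sEquiv a ha b h.symm

/-- The endpoints have distance two, so `sw z a b` lies in `S` and splits the move into two steps of
distance one. -/
lemma IsSwitchable.connected_of_unitMove_of_lt (hS : IsSwitchable s t S) {p q z : Fin n}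
    (hz : z = p ∨ z = q) (hzt : z.val < t) (hp : p.val < s) (hq : q.val < s)
    (ha : a ∈ S) (h : UnitMove p q a b) : Connected S a b := by
  have hb := hS.mem_of_sEquiv' ha (h.sEquiv hp hq)
  have hup := h.up
  have hdown := h.down
  have h2 : hammingDist a b = 2 :=
    hammingDist_eq_two_of h.ne (by intro hc; rw [hc] at hup; omega)
      (by intro hc; rw [hc] at hdown; omega) h.off
  have hm := hS.sw_mem a ha b hb h2 z hzt
  have h1 : Connected S a (sw z a b) :=
    connected_of_forall_ne (i := z) ha hm fun k hk => by simp [hk]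
  refine h1.trans ?_
  rcases hz with rfl | rfl
  · refine connected_of_forall_ne (i := q) hm hb fun k hk => ?_
    by_cases hkz : k = z
    · subst hkz; simp
    · simp [hkz, h.off k hkz hk]
  · refine connected_of_forall_ne (i := p) hm hb fun k hk => ?_
    by_cases hkz : k = z
    · subst hkz; simp
    · simp [hkz, h.off k hk hkz]

/-- A move avoiding `z` is routed through `z`: the unit is first taken from `z` and then repaid from
`q`, or first stored at `z` if `a z = 0`. There is room for it because `r z ≥ 2`. -/
lemma IsSwitchable.connected_of_unitMove (hS : IsSwitchable s t S) (hr : ∀ i, 2 ≤ r i)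
    {p q z : Fin n} (hzs : z.val < s) (hzt : z.val < t) (hp : p.val < s) (hq : q.val < s)
    (ha : a ∈ S) (h : UnitMove p q a b) : Connected S a b := by
  by_cases hzp : z = p
  · exact hS.connected_of_unitMove_of_lt (.inl hzp) hzt hp hq ha h
  by_cases hzq : z = q
  · exact hS.connected_of_unitMove_of_lt (.inr hzq) hzt hp hq ha h
  have hup := h.up
  have hdown := h.down
  have hbp := (b p).isLt
  have hpq := h.ne
  have hrz := hr z
  by_cases h0 : 0 < (a z).val
  · obtain ⟨c, hc⟩ := exists_unitMove (a := a) (p := p) (q := z) (Ne.symm hzp) (by omega) h0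
    have hcq : a q = c q := hc.off q hpq.symm (Ne.symm hzq)
    have hcz := hc.down
    have hcp := hc.up
    refine (hS.connected_of_unitMove_of_lt (.inr rfl) hzt hp hzs ha hc).trans ?_
    refine hS.connected_of_unitMove_of_lt (p := z) (q := q) (.inl rfl) hzt hzs hq
      (hS.mem_of_sEquiv' ha (hc.sEquiv hp hzs)) ⟨hzq, ?_, ?_, ?_⟩
    · rw [← h.off z hzp hzq]; omega
    · rw [← hcq]; exact hdown
    · intro k h1 h2
      by_cases hkp : k = p
      · subst hkp; apply Fin.ext; omega
      · rw [← hc.off k hkp h1, h.off k hkp h2]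
  · obtain ⟨c, hc⟩ := exists_unitMove (a := a) (p := z) (q := q) hzq (by omega) (by omega)
    have hcp : a p = c p := hc.off p (Ne.symm hzp) hpq
    have hcz := hc.up
    have hcq := hc.down
    refine (hS.connected_of_unitMove_of_lt (.inl rfl) hzt hzs hq ha hc).trans ?_
    refine hS.connected_of_unitMove_of_lt (p := p) (q := z) (.inr rfl) hzt hp hzs
      (hS.mem_of_sEquiv' ha (hc.sEquiv hzs hq)) ⟨Ne.symm hzp, ?_, ?_, ?_⟩
    · rw [← hcp]; exact hup
    · rw [← h.off z hzp hzq]; omega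
    · intro k h1 h2
      by_cases hkq : k = q
      · subst hkq; apply Fin.ext; omega
      · rw [← hc.off k h2 hkq, h.off k h1 hkq]

lemma SEquiv.exists_lt (h : SEquiv s a b) (hab : a ≠ b) :
    ∃ p : Fin n, p.val < s ∧ (a p).val < b p := by
  by_contra! hc
  refine hab (funext fun k => ?_)
  by_cases hk : k.val < s
  · have := (Finset.sum_eq_sum_iff_of_le (s := Finset.univ.filter fun i : Fin n => i.val < s)
      (f := fun i => (b i).val) (g := fun i => (a i).val)
      fun i hi => hc i (by simpa using hi)).1 h.1.symm k (by simpa using hk)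
    exact Fin.ext this.symm
  · exact h.2 k (by omega)

/-- A unit move from a position where `a` is too large to one where it is too small lowers the total
excess of `a` over `b`, a sum of truncated differences. -/
lemma IsSwitchable.connected_of_sEquiv (hS : IsSwitchable s t S) (hr : ∀ i, 2 ≤ r i)
    (hs : 1 ≤ s) (ht : 1 ≤ t) (ha : a ∈ S) (h : SEquiv s a b) : Connected S a b := by
  induction hN : ∑ k, ((a k).val - (b k).val) using Nat.strong_induction_on generalizing a with
  | _ N ih =>
    by_cases hab : a = b
    · exact hab ▸ .refl ha
    obtain ⟨p, hps, hp⟩ := h.exists_lt hab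
    obtain ⟨q, hqs, hq⟩ := h.symm.exists_lt (Ne.symm hab)
    have hpq : p ≠ q := by rintro rfl; omega
    have := (b p).isLt
    obtain ⟨c, hc⟩ := exists_unitMove (a := a) hpq (by omega) (by omega)
    have hac := hc.sEquiv (s := s) hps hqs
    have hz : 0 < n := p.pos
    refine (hS.connected_of_unitMove hr (z := ⟨0, hz⟩) hs ht hps hqs ha hc).trans
      (ih _ ?_ (hS.mem_of_sEquiv' ha hac) (hac.symm.trans h) rfl)
    rw [← hN]
    have hup := hc.up
    have hdown := hc.down
    refine Finset.sum_lt_sum (fun k _ => ?_) ⟨q, Finset.mem_univ _, by omega⟩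
    by_cases hkp : k = p
    · subst hkp; omega
    by_cases hkq : k = q
    · subst hkq; omega
    rw [hc.off k hkp hkq]
variable {K : Type*} [Field K]

/-! ### Congruences modulo `P_S` -/

lemma x_eq_of_sEquiv (h : SEquiv s a b) : x K s a = x K s b :=
  congrArg MvPolynomial.X (Quotient.sound h)

lemma minor_mem_P (hi : i.val < t) (h : Connected S a b) : minor K s i a b ∈ P K s t S :=
  Ideal.mem_sup_right (Ideal.subset_span ⟨i, a, b, hi, h, rfl⟩)

lemma x_mem_P (ha : a ∉ S) : x K s a ∈ P K s t S :=
  Ideal.mem_sup_left (Ideal.subset_span ⟨a, ha, rfl⟩)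

lemma mk_sw (hi : i.val < t) (h : Connected S a b) :
    Ideal.Quotient.mk (P K s t S) (x K s a * x K s b) =
      Ideal.Quotient.mk (P K s t S) (x K s (sw i a b) * x K s (sw i b a)) :=
  Ideal.Quotient.eq.2 (minor_mem_P hi h)

/-- The pair `(a', c')` arises from `(a, c)` by moving one unit of the block sum from `c` to `a`,
without leaving the component and without changing the product of the variables modulo `P_S`. -/
structure Shift (K : Type*) [Field K] (s t : ℕ) (S : Set (Index r)) (a c a' c' : Index r) :
    Prop where
  conn_left : Connected S a a'
  conn_right : Connected S c c'
  agree_left : ∀ k : Fin n, s ≤ k.val → a' k = a k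
  agree_right : ∀ k : Fin n, s ≤ k.val → c' k = c k
  sum_left : blockSum s a' = blockSum s a + 1
  sum_right : blockSum s c = blockSum s c' + 1
  mk_eq : Ideal.Quotient.mk (P K s t S) (x K s a * x K s c) =
    Ideal.Quotient.mk (P K s t S) (x K s a' * x K s c')

lemma Shift.of_sEquiv {a' c' a₁ c₁ : Index r} (h : Shift K s t S a₁ c₁ a' c')
    (ha : SEquiv s a a₁) (hc : SEquiv s c c₁) (hac : Connected S a a₁) (hcc : Connected S c c₁) :
    Shift K s t S a c a' c' where
  conn_left := hac.trans h.conn_left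
  conn_right := hcc.trans h.conn_right
  agree_left k hk := (h.agree_left k hk).trans (ha.2 k hk).symm
  agree_right k hk := (h.agree_right k hk).trans (hc.2 k hk).symm
  sum_left := by rw [h.sum_left, (sEquiv_iff.1 ha).1]
  sum_right := by rw [(sEquiv_iff.1 hc).1, h.sum_right]
  mk_eq := by rw [x_eq_of_sEquiv ha, x_eq_of_sEquiv hc, h.mk_eq]

/-- Exchange the `z`-entries, make a unit move from `j` to `z` on the second index, and exchange
back. The net effect raises `a z` and lowers `c j` by one; the unit move does not change the
variable. -/
lemma IsSwitchable.shift_of_lt_of_pos (hS : IsSwitchable s t S) (hr : ∀ i, 2 ≤ r i) {z : Fin n}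
    (hzs : z.val < s) (hzt : z.val < t) (hjz : j ≠ z) (hjs : j.val < s) (h : Connected S a c)
    (ha : (a z).val + 1 < r z) (hc : 0 < (c j).val) :
    ∃ a' c', Shift K s t S a c a' c' := by
  obtain ⟨d, hd⟩ := exists_unitMove (a := sw z c a) (p := z) (q := j) hjz.symm
    (by simpa using ha) (by simpa [hjz] using hc)
  have hcd := hS.connected_sw hzt h.symm
  have hde := hd.sEquiv hzs hjs
  have hcd' := hS.connected_of_unitMove hr hzs hzt hzs hjs hcd.2.1 hd
  have h1 : Connected S (sw z a c) d :=
    (hS.connected_sw hzt h).symm.trans (h.trans (hcd.trans hcd'))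
  have hup : (d z).val = a z + 1 := by simpa using hd.up
  have hsum : blockSum s (sw z (sw z a c) d) = blockSum s a + 1 := by
    have := blockSum_of_forall_ne (a := sw z (sw z a c) d) (b := a) hzs fun k hk => by simp [hk]
    rw [sw_self_pos] at this
    omega
  refine ⟨sw z (sw z a c) d, sw z d (sw z a c), ?_, ?_, ?_, ?_, hsum, ?_, ?_⟩
  · exact (hS.connected_sw hzt h).trans (hS.connected_sw hzt h1)
  · exact (hcd.trans hcd').trans (hS.connected_sw hzt h1.symm)
  · intro k hk
    have : k ≠ z := by rintro rfl; omega
    simp [this]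
  · intro k hk
    have : k ≠ z := by rintro rfl; omega
    rw [sw_of_ne this, ← hde.2 k hk, sw_of_ne this]
  · have e1 := blockSum_sw_add (s := s) z a c
    have e2 := blockSum_sw_add (s := s) z (sw z a c) d
    have e3 := (sEquiv_iff.1 hde).1
    omega
  · rw [mk_sw hzt h, x_eq_of_sEquiv hde, mk_sw hzt h1]

/-- The mirror image: the unit move is made on the first index, so that `a j` rises and `c z` drops.
-/
lemma IsSwitchable.shift_of_pos_of_lt (hS : IsSwitchable s t S) (hr : ∀ i, 2 ≤ r i) {z : Fin n}
    (hzs : z.val < s) (hzt : z.val < t) (hjz : j ≠ z) (hjs : j.val < s) (h : Connected S a c)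
    (ha : (a j).val + 1 < r j) (hc : 0 < (c z).val) :
    ∃ a' c', Shift K s t S a c a' c' := by
  obtain ⟨d, hd⟩ := exists_unitMove (a := sw z a c) (p := j) (q := z) hjz
    (by simpa [hjz] using ha) (by simpa using hc)
  have had := hS.connected_sw hzt h
  have hde := hd.sEquiv hjs hzs
  have had' := hS.connected_of_unitMove hr hzs hzt hjs hzs had.2.1 hd
  have h1 : Connected S d (sw z c a) :=
    (had.trans had').symm.trans (h.trans (hS.connected_sw hzt h.symm))
  have hdown : (c z).val = d z + 1 := by simpa using hd.down
  have hsum : blockSum s c = blockSum s (sw z (sw z c a) d) + 1 := by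
    have := blockSum_of_forall_ne (a := sw z (sw z c a) d) (b := c) hzs fun k hk => by simp [hk]
    rw [sw_self_pos] at this
    omega
  refine ⟨sw z d (sw z c a), sw z (sw z c a) d, ?_, ?_, ?_, ?_, ?_, hsum, ?_⟩
  · exact (had.trans had').trans (hS.connected_sw hzt h1)
  · exact (hS.connected_sw hzt h.symm).trans (hS.connected_sw hzt h1.symm)
  · intro k hk
    have : k ≠ z := by rintro rfl; omega
    rw [sw_of_ne this, ← hde.2 k hk, sw_of_ne this]
  · intro k hk
    have : k ≠ z := by rintro rfl; omega
    simp [this]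
  · have e1 := blockSum_sw_add (s := s) z a c
    have e2 := blockSum_sw_add (s := s) z d (sw z c a)
    have e3 := (sEquiv_iff.1 hde).1
    omega
  · rw [mk_sw hzt h, x_eq_of_sEquiv hde, mk_sw hzt h1]

lemma exists_pos_of_blockSum_pos (h : 0 < blockSum s a) :
    ∃ k : Fin n, k.val < s ∧ 0 < (a k).val := by
  obtain ⟨k, hk, h0⟩ := Finset.exists_ne_zero_of_sum_ne_zero h.ne'
  exact ⟨k, by simpa using hk, Nat.pos_of_ne_zero h0⟩

lemma exists_lt_of_blockSum_lt (h : blockSum s a < maxBlockSum r s) :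
    ∃ k : Fin n, k.val < s ∧ (a k).val + 1 < r k := by
  obtain ⟨k, hk, h0⟩ := Finset.exists_lt_of_sum_lt h
  exact ⟨k, by simpa using hk, by omega⟩

lemma IsSwitchable.exists_shift (hS : IsSwitchable s t S) (hr : ∀ i, 2 ≤ r i) (hs : 2 ≤ s)
    (hsn : s ≤ n) (ht : 1 ≤ t) (h : Connected S a c) (ha : blockSum s a < maxBlockSum r s)
    (hc : 0 < blockSum s c) : ∃ a' c', Shift K s t S a c a' c' := by
  obtain ⟨k, hks, hk⟩ := exists_lt_of_blockSum_lt ha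
  obtain ⟨l, hls, hl⟩ := exists_pos_of_blockSum_pos hc
  obtain ⟨z, hz⟩ : ∃ z : Fin n, z.val = 0 := ⟨⟨0, by omega⟩, rfl⟩
  have hzs : z.val < s := by omega
  have hzt : z.val < t := by omega
  by_cases hA : ∃ j : Fin n, j ≠ z ∧ j.val < s ∧ (a j).val + 1 < r j
  · obtain ⟨j, hjz, hjs, hj⟩ := hA
    by_cases hcz : 0 < (c z).val
    · exact hS.shift_of_pos_of_lt hr hzs hzt hjz hjs h hj hcz
    have hlz : l ≠ z := by rintro rfl; exact hcz hl
    by_cases haz : (a z).val + 1 < r z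
    · exact hS.shift_of_lt_of_pos hr hzs hzt hlz hls h haz hl
    -- Here `a z` is maximal, hence positive. A unit move inside `a` from `z` to `j` makes room at
    -- `z`.
    · have := hr z
      obtain ⟨d, hd⟩ := exists_unitMove (a := a) hjz hj (by omega)
      have had := hS.connected_of_unitMove hr hzs hzt hjs hzs h.1 hd
      have hdown := hd.down
      have := (a z).isLt
      obtain ⟨a', c', h'⟩ := hS.shift_of_lt_of_pos (K := K) hr hzs hzt hlz hls
        (had.symm.trans h) (by omega) hl
      exact ⟨a', c', h'.of_sEquiv (hd.sEquiv hjs hzs) ⟨rfl, fun _ _ => rfl⟩ had (.refl h.2.1)⟩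
  · push Not at hA
    have hkz : k = z := by
      by_contra hkz
      exact absurd hk (not_lt.2 (hA k hkz hks))
    rw [hkz] at hk
    by_cases hlz : l = z
    · rw [hlz] at hl
      obtain ⟨j, hj⟩ : ∃ j : Fin n, j.val = 1 := ⟨⟨1, by omega⟩, rfl⟩
      have hjz : j ≠ z := by rintro rfl; omega
      have hjs : j.val < s := by omega
      by_cases hcj : 0 < (c j).val
      · exact hS.shift_of_lt_of_pos hr hzs hzt hjz hjs h hk hcj
      -- The only unit available in `c` may sit at `z` itself; it is first moved to the second block
      -- position `j`, which exists as `s ≥ 2`.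
      · have := hr j
        obtain ⟨d, hd⟩ := exists_unitMove (a := c) hjz (by omega) hl
        have hcd := hS.connected_of_unitMove hr hzs hzt hjs hzs h.2.1 hd
        have hup := hd.up
        obtain ⟨a', c', h'⟩ := hS.shift_of_lt_of_pos (K := K) hr hzs hzt hjz hjs
          (h.trans hcd) hk (by omega)
        exact ⟨a', c', h'.of_sEquiv ⟨rfl, fun _ _ => rfl⟩ (hd.sEquiv hjs hzs) (.refl h.1) hcd⟩
    · exact hS.shift_of_lt_of_pos hr hzs hzt hlz hls h hk hl

/-! ### The toric parametrization -/

/-- The coordinates of the weight of an index. -/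
inductive Label (r : Fin n → ℕ) : Type
  | rest (C : Set (Index r)) (f : Fin n → ℕ)
  | pos (C : Set (Index r)) (i : Fin n) (v : ℕ)
  | up (C : Set (Index r))
  | down (C : Set (Index r))

/-- The connected component of an index. -/
def component (S : Set (Index r)) (a : Index r) : Set (Index r) := {b | Connected S a b}

lemma component_eq (h : Connected S a b) : component S a = component S b :=
  Set.ext fun _ => ⟨h.symm.trans, h.trans⟩

lemma connected_of_component_eq (hb : b ∈ S) (h : component S a = component S b) :
    Connected S a b := by
  have : b ∈ component S b := Connected.refl hb
  rwa [← h] at this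

/-- The components of an index that neither switches nor `s`-equivalence can change. -/
def tail (s t : ℕ) (a : Index r) (i : Fin n) : ℕ :=
  if i.val < t ∨ i.val < s then 0 else a i

open Classical in
/-- The exponent vector of the image of the variable `x_a` under the toric parametrization. -/
noncomputable def weight (s t : ℕ) (S : Set (Index r)) (a : Index r) : Label r → ℕ
  | .rest C f => if C = component S a ∧ f = tail s t a then 1 else 0
  | .pos C i v =>
      if C = component S a ∧ (i.val < t ∧ (s ≤ i.val ∨ s = 1)) ∧ v = a i then 1 else 0
  | .up C => if C = component S a then blockSum s a else 0
  | .down C => if C = component S a then maxBlockSum r s - blockSum s a else 0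

/-- For `s = 1` nothing is identified, so the weight may record the single block entry by a `pos`
label like any other switchable entry; no shifts are needed then. -/
lemma eq_of_sEquiv_one (h : SEquiv 1 a b) : a = b := by
  funext k
  by_cases hk : k.val < 1
  · have h1 : (Finset.univ.filter fun i : Fin n => i.val < 1) = {k} := by
      ext i
      simp only [Finset.mem_filter, Finset.mem_univ, true_and, Finset.mem_singleton, Fin.ext_iff]
      omega
    have h2 := h.1
    rw [h1, Finset.sum_singleton, Finset.sum_singleton] at h2
    exact Fin.ext h2
  · exact h.2 k (by omega)

lemma weight_eq_of_sEquiv (h : SEquiv s a b) (hc : Connected S a b) :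
    weight s t S a = weight s t S b := by
  have h1 := component_eq hc
  have h2 := (sEquiv_iff.1 h).1
  have h3 : tail s t a = tail s t b := by
    funext k
    unfold tail
    split_ifs with hk
    · rfl
    · rw [h.2 k (by omega)]
  have h4 : ∀ i : Fin n, (s ≤ i.val ∨ s = 1) → a i = b i := by
    rintro i (hi | rfl)
    · exact h.2 i hi
    · rw [eq_of_sEquiv_one h]
  funext L
  cases L with
  | rest C f => simp only [weight, h1, h3]
  | pos C i v =>
    by_cases hi : i.val < t ∧ (s ≤ i.val ∨ s = 1)
    · simp only [weight, h1, h4 i hi.2]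
    · simp only [weight, hi, false_and, and_false]
  | up C => simp only [weight, h1, h2]
  | down C => simp only [weight, h1, h2]

lemma IsSwitchable.weight_sw_add (hS : IsSwitchable s t S) (hi : i.val < t)
    (h : Connected S a b) :
    weight s t S (sw i a b) + weight s t S (sw i b a) = weight s t S a + weight s t S b := by
  have h1 := component_eq (hS.connected_sw hi h)
  have h2 := component_eq (hS.connected_sw hi h.symm)
  have h3 := component_eq h
  have h4 : ∀ a b : Index r, tail s t (sw i a b) = tail s t a := fun a b => by
    funext k
    by_cases hk : k = i
    · subst hk; simp [tail, hi]
    · simp [tail, hk]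
  funext L
  cases L with
  | rest C f => simp only [Pi.add_apply, weight, h4, ← h1, ← h2]
  | pos C k v =>
    by_cases hk : k = i
    · subst hk
      simp only [Pi.add_apply, weight, sw_self_pos, ← h1, ← h2, ← h3]
      exact add_comm _ _
    · simp only [Pi.add_apply, weight, sw_of_ne hk, ← h1, ← h2]
  | up C =>
    simp only [Pi.add_apply, weight, ← h1, ← h2, ← h3]
    split_ifs
    · exact blockSum_sw_add i a b
    · rfl
  | down C =>
    simp only [Pi.add_apply, weight, ← h1, ← h2, ← h3]
    split_ifs
    -- The bounds by `maxBlockSum` make the truncated subtractions exact.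
    · have := blockSum_sw_add (s := s) i a b
      have := blockSum_le (s := s) a
      have := blockSum_le (s := s) b
      have := blockSum_le (s := s) (sw i a b)
      have := blockSum_le (s := s) (sw i b a)
      omega
    · rfl

open Classical in
/-- The toric parametrization: it sends `x_a` to a monomial if `a ∈ S`, and to zero otherwise. -/
noncomputable def toricMap (K : Type*) [Field K] (s t : ℕ) (S : Set (Index r)) :
    Ring K r s →ₐ[K] AddMonoidAlgebra K (Label r → ℕ) :=
  MvPolynomial.aeval fun q =>
    if q.out ∈ S then AddMonoidAlgebra.single (weight s t S q.out) 1 else 0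

lemma out_sEquiv (a : Index r) : SEquiv s (Quotient.mk (sSetoid r s) a).out a :=
  Quotient.mk_out (s := sSetoid r s) a

lemma toricMap_x_of_notMem (hS : IsSwitchable s t S) (ha : a ∉ S) :
    toricMap K s t S (x K s a) = 0 := by
  rw [toricMap, x, MvPolynomial.aeval_X, if_neg]
  exact fun h => ha (hS.mem_of_sEquiv' h (out_sEquiv a))

/-- The representative `q.out` does not matter: it is `s`-equivalent to `a`, hence connected to it,
hence of the same weight. -/
lemma toricMap_x_of_mem (hS : IsSwitchable s t S) (hr : ∀ i, 2 ≤ r i) (hs : 1 ≤ s) (ht : 1 ≤ t)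
    (ha : a ∈ S) :
    toricMap K s t S (x K s a) = AddMonoidAlgebra.single (weight s t S a) 1 := by
  have h := hS.mem_of_sEquiv' ha (out_sEquiv (s := s) a).symm
  rw [toricMap, x, MvPolynomial.aeval_X, if_pos h, weight_eq_of_sEquiv (out_sEquiv a)
    (hS.connected_of_sEquiv hr hs ht h (out_sEquiv a))]

lemma P_le_ker_toricMap (hS : IsSwitchable s t S) (hr : ∀ i, 2 ≤ r i) (hs : 1 ≤ s) (ht : 1 ≤ t) :
    P K s t S ≤ RingHom.ker (toricMap K s t S) := by
  refine sup_le (Ideal.span_le.2 ?_) (Ideal.span_le.2 ?_)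
  · rintro _ ⟨a, ha, rfl⟩
    exact toricMap_x_of_notMem hS ha
  · rintro _ ⟨i, a, b, hi, h, rfl⟩
    have h1 := (hS.connected_sw hi h).2.1
    have h2 := (hS.connected_sw hi h.symm).2.1
    rw [SetLike.mem_coe, RingHom.mem_ker, minor, map_sub, map_mul, map_mul,
      toricMap_x_of_mem hS hr hs ht h.1, toricMap_x_of_mem hS hr hs ht h.2.1,
      toricMap_x_of_mem hS hr hs ht h1, toricMap_x_of_mem hS hr hs ht h2,
      AddMonoidAlgebra.single_mul_single, AddMonoidAlgebra.single_mul_single,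
      hS.weight_sw_add hi h, sub_self]

lemma x_mem_P_iff (hS : IsSwitchable s t S) (hr : ∀ i, 2 ≤ r i) (hs : 1 ≤ s) (ht : 1 ≤ t) :
    x K s a ∈ P K s t S ↔ a ∉ S := by
  refine ⟨fun h ha => ?_, x_mem_P⟩
  have := P_le_ker_toricMap hS hr hs ht h
  rw [RingHom.mem_ker, toricMap_x_of_mem hS hr hs ht ha] at this
  simp at this

/-! ### The kernel of the parametrization -/

/-- The monomial with the given multiset of indices. -/
noncomputable def mon (K : Type*) [Field K] (s : ℕ) (l : Multiset (Index r)) : Ring K r s :=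
  (l.map (x K s)).prod

/-- The weight of the monomial with the given multiset of indices. -/
noncomputable def monWeight (s t : ℕ) (S : Set (Index r)) (l : Multiset (Index r)) :
    Label r → ℕ :=
  (l.map (weight s t S)).sum

lemma mon_cons (a : Index r) (l : Multiset (Index r)) : mon K s (a ::ₘ l) = x K s a * mon K s l := by
  simp [mon]

lemma monWeight_cons (a : Index r) (l : Multiset (Index r)) :
    monWeight s t S (a ::ₘ l) = weight s t S a + monWeight s t S l := by
  simp [monWeight]

lemma toricMap_mon (hS : IsSwitchable s t S) (hr : ∀ i, 2 ≤ r i) (hs : 1 ≤ s) (ht : 1 ≤ t)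
    {l : Multiset (Index r)} (hl : ∀ a ∈ l, a ∈ S) :
    toricMap K s t S (mon K s l) = AddMonoidAlgebra.single (monWeight s t S l) 1 := by
  induction l using Multiset.induction with
  | empty =>
    rw [mon, Multiset.map_zero, Multiset.prod_zero, map_one]
    rfl
  | cons a l ih =>
    rw [mon_cons, monWeight_cons, map_mul, ih fun b hb => hl b (Multiset.mem_cons_of_mem hb),
      toricMap_x_of_mem hS hr hs ht (hl a (Multiset.mem_cons_self a l)),
      AddMonoidAlgebra.single_mul_single, one_mul]

lemma toricMap_mon_of_notMem (hS : IsSwitchable s t S) {l : Multiset (Index r)} (ha : a ∈ l)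
    (haS : a ∉ S) : toricMap K s t S (mon K s l) = 0 := by
  obtain ⟨l, rfl⟩ := Multiset.exists_cons_of_mem ha
  rw [mon_cons, map_mul, toricMap_x_of_notMem hS haS, zero_mul]

/-- Two monomials supported on `S` are congruent modulo `P_S`. -/
structure Cong (K : Type*) [Field K] (s t : ℕ) (S : Set (Index r)) (l l' : Multiset (Index r)) :
    Prop where
  left : ∀ a ∈ l, a ∈ S
  right : ∀ a ∈ l', a ∈ S
  mk_eq : Ideal.Quotient.mk (P K s t S) (mon K s l) = Ideal.Quotient.mk (P K s t S) (mon K s l')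

lemma Cong.trans {l l' l'' : Multiset (Index r)} (h : Cong K s t S l l')
    (h' : Cong K s t S l' l'') : Cong K s t S l l'' :=
  ⟨h.left, h'.right, h.mk_eq.trans h'.mk_eq⟩

lemma Cong.cons {l l' : Multiset (Index r)} (h : Cong K s t S l l') (ha : a ∈ S) :
    Cong K s t S (a ::ₘ l) (a ::ₘ l') where
  left b hb := (Multiset.mem_cons.1 hb).elim (fun e => e ▸ ha) (h.left b)
  right b hb := (Multiset.mem_cons.1 hb).elim (fun e => e ▸ ha) (h.right b)
  mk_eq := by rw [mon_cons, mon_cons, map_mul, map_mul, h.mk_eq]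

lemma Cong.of_pair {a' c' : Index r} {l : Multiset (Index r)} (ha : a' ∈ S) (hc : c' ∈ S)
    (hl : ∀ e ∈ a ::ₘ c ::ₘ l, e ∈ S)
    (h : Ideal.Quotient.mk (P K s t S) (x K s a * x K s c) =
      Ideal.Quotient.mk (P K s t S) (x K s a' * x K s c')) :
    Cong K s t S (a ::ₘ c ::ₘ l) (a' ::ₘ c' ::ₘ l) where
  left := hl
  right e he := by
    rcases Multiset.mem_cons.1 he with rfl | he
    · exact ha
    rcases Multiset.mem_cons.1 he with rfl | he
    · exact hc
    · exact hl e (Multiset.mem_cons_of_mem (Multiset.mem_cons_of_mem he))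
  mk_eq := by
    simp only [mon_cons, ← mul_assoc]
    rw [map_mul, h, ← map_mul]

/-- Weights are preserved by every reduction, since `P K s t S` lies in the kernel of the toric map.
-/
lemma Cong.monWeight_eq (hS : IsSwitchable s t S) (hr : ∀ i, 2 ≤ r i) (hs : 1 ≤ s) (ht : 1 ≤ t)
    {l l' : Multiset (Index r)} (h : Cong K s t S l l') :
    monWeight s t S l = monWeight s t S l' := by
  have h1 := P_le_ker_toricMap hS hr hs ht (Ideal.Quotient.eq.1 h.mk_eq)
  rw [RingHom.mem_ker, map_sub, toricMap_mon hS hr hs ht h.left, toricMap_mon hS hr hs ht h.right,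
    sub_eq_zero] at h1
  exact AddMonoidAlgebra.single_left_injective one_ne_zero h1

lemma exists_weight_pos {l : Multiset (Index r)} {L : Label r} (h : 0 < monWeight s t S l L) :
    ∃ c ∈ l, 0 < weight s t S c L := by
  by_contra! hc
  have h1 : monWeight s t S l L = (l.map fun a => weight s t S a L).sum := by
    have := map_multiset_sum (Pi.evalAddMonoidHom (fun _ : Label r => ℕ) L)
      (l.map (weight s t S))
    rw [Multiset.map_map] at this
    exact this
  have h2 : (l.map fun a => weight s t S a L).sum = 0 := by
    refine Multiset.sum_eq_zero fun y hy => ?_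
    obtain ⟨a, ha, rfl⟩ := Multiset.mem_map.1 hy
    exact Nat.le_zero.1 (hc a ha)
  omega

/-- The totals at `L` agree, so what `a` lacks against `b` is made up by another factor. This
supplies the partner for each exchange below. -/
lemma exists_weight_pos_of_lt {l l' : Multiset (Index r)} {L : Label r}
    (hw : monWeight s t S (a ::ₘ l) = monWeight s t S (b ::ₘ l'))
    (h : weight s t S a L < weight s t S b L) : ∃ c ∈ l, 0 < weight s t S c L := by
  refine exists_weight_pos ?_
  have := congrFun hw L
  rw [monWeight_cons, monWeight_cons, Pi.add_apply, Pi.add_apply] at this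
  omega

lemma exists_connected_tail_eq {l l' : Multiset (Index r)} (hl : ∀ e ∈ l, e ∈ S)
    (hw : monWeight s t S l = monWeight s t S (b ::ₘ l')) :
    ∃ a ∈ l, Connected S b a ∧ tail s t a = tail s t b := by
  have h1 : weight s t S b (.rest (component S b) (tail s t b)) = 1 := by simp [weight]
  obtain ⟨a, ha, h⟩ := exists_weight_pos (s := s) (t := t) (S := S) (l := l)
    (L := .rest (component S b) (tail s t b)) (by
      rw [hw, monWeight_cons, Pi.add_apply, h1]; omega)
  simp only [weight] at h
  split_ifs at h with hc
  · exact ⟨a, ha, connected_of_component_eq (hl a ha) hc.1, hc.2.symm⟩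
  · omega

lemma tail_eq_iff : tail s t a = tail s t b ↔ ∀ k : Fin n, t ≤ k.val → s ≤ k.val → a k = b k := by
  refine ⟨fun h k h1 h2 => ?_, fun h => ?_⟩
  · have := congrFun h k
    rw [tail, tail, if_neg (by omega), if_neg (by omega)] at this
    exact Fin.ext this
  · funext k
    unfold tail
    split_ifs
    · rfl
    · rw [h k (by omega) (by omega)]

/-- The entries in `F` are corrected one by one: if `a i ≠ b i`, some other factor in the same
component has entry `b i`, and switching `i` with it fixes that entry and disturbs no other entry of
`a`. -/
lemma exists_cong_agree (hS : IsSwitchable s t S) (hr : ∀ i, 2 ≤ r i) (hs : 1 ≤ s) (ht : 1 ≤ t)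
    {l l' : Multiset (Index r)} (hl : ∀ e ∈ l, e ∈ S)
    (hw : monWeight s t S l = monWeight s t S (b ::ₘ l')) (F : Finset (Fin n)) :
    ∃ a l₀, Cong K s t S l (a ::ₘ l₀) ∧ Connected S b a ∧
      (∀ k : Fin n, t ≤ k.val → s ≤ k.val → a k = b k) ∧
      ∀ k ∈ F, k.val < t → (s ≤ k.val ∨ s = 1) → a k = b k := by
  induction F using Finset.induction_on with
  | empty =>
    obtain ⟨a, ha, hc, htail⟩ := exists_connected_tail_eq hl hw
    obtain ⟨l₀, rfl⟩ := Multiset.exists_cons_of_mem ha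
    exact ⟨a, l₀, ⟨hl, hl, rfl⟩, hc, tail_eq_iff.1 htail, by simp⟩
  | insert i F _ ih =>
    obtain ⟨a, l₀, hcong, hba, htail, hF⟩ := ih
    by_cases hi : (i.val < t ∧ (s ≤ i.val ∨ s = 1)) ∧ a i ≠ b i
    · obtain ⟨⟨hit, his⟩, hne⟩ := hi
      have hne' : (b i).val ≠ a i := fun h => hne (Fin.ext h.symm)
      have hw' := (hcong.monWeight_eq hS hr hs ht).symm.trans hw
      obtain ⟨c, hc, hpos⟩ := exists_weight_pos_of_lt (L := .pos (component S b) i (b i)) hw' (by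
        simp [weight, hit, his, hne'])
      obtain ⟨l₁, rfl⟩ := Multiset.exists_cons_of_mem hc
      simp only [weight] at hpos
      split_ifs at hpos with hcond
      swap
      · omega
      have hcS : c ∈ S := hcong.right c (by simp)
      have hbc := connected_of_component_eq hcS hcond.1
      have hac := hba.symm.trans hbc
      have ha' := hS.connected_sw hit hac
      have hc' := hS.connected_sw hit hac.symm
      refine ⟨sw i a c, sw i c a ::ₘ l₁,
        hcong.trans (.of_pair ha'.2.1 hc'.2.1 hcong.right (mk_sw hit hac)), hba.trans ha', ?_, ?_⟩
      · intro k h1 h2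
        have : k ≠ i := by rintro rfl; omega
        rw [sw_of_ne this, htail k h1 h2]
      · intro k hk h1 h2
        by_cases hki : k = i
        · subst hki
          rw [sw_self_pos]
          exact Fin.ext hcond.2.2.symm
        · rw [sw_of_ne hki]
          exact hF k (Finset.mem_of_mem_insert_of_ne hk hki) h1 h2
    · refine ⟨a, l₀, hcong, hba, htail, fun k hk h1 h2 => ?_⟩
      by_cases hki : k = i
      · subst hki
        by_contra hne
        exact hi ⟨⟨h1, h2⟩, hne⟩
      · exact hF k (Finset.mem_of_mem_insert_of_ne hk hki) h1 h2

lemma exists_cong_sEquiv_of_two_le (hS : IsSwitchable s t S) (hr : ∀ i, 2 ≤ r i) (hs : 2 ≤ s)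
    (hsn : s ≤ n) (ht : 1 ≤ t) {l l' : Multiset (Index r)}
    (hw : monWeight s t S l = monWeight s t S (b ::ₘ l'))
    {l₀ : Multiset (Index r)} (hcong : Cong K s t S l (a ::ₘ l₀)) (hba : Connected S b a)
    (hagree : ∀ k : Fin n, s ≤ k.val → a k = b k) :
    ∃ a l₀, Cong K s t S l (a ::ₘ l₀) ∧ SEquiv s a b := by
  have hle := blockSum_le (s := s) a
  have hle' := blockSum_le (s := s) b
  induction hN : (blockSum s a - blockSum s b) + (blockSum s b - blockSum s a)
    generalizing a l₀ with
  | zero => exact ⟨a, l₀, hcong, sEquiv_iff.2 ⟨by omega, hagree⟩⟩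
  | succ N ih =>
    have hw' := (hcong.monWeight_eq hS hr (by omega) ht).symm.trans hw
    have hcomp := component_eq hba
    rcases lt_or_gt_of_ne (show blockSum s a ≠ blockSum s b by omega) with hlt | hlt
    · obtain ⟨c, hc, hpos⟩ := exists_weight_pos_of_lt (L := .up (component S b)) hw' (by
        simpa only [weight, if_pos, hcomp] using hlt)
      obtain ⟨l₁, rfl⟩ := Multiset.exists_cons_of_mem hc
      simp only [weight] at hpos
      split_ifs at hpos with hcond
      swap
      · omega
      have hac := hba.symm.trans (connected_of_component_eq (hcong.right c (by simp)) hcond)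
      obtain ⟨a', c', h⟩ := hS.exists_shift (K := K) hr hs hsn ht hac (by omega) hpos
      have := h.sum_left
      exact ih (hcong.trans (.of_pair h.conn_left.2.1 h.conn_right.2.1 hcong.right h.mk_eq))
        (hba.trans h.conn_left) (fun k hk => (h.agree_left k hk).trans (hagree k hk))
        (blockSum_le _) (by omega)
    -- When the sum of `a` is too large, the `down` label yields a factor with room to receive a
    -- unit; the shift then runs from `a` to `c`.
    · obtain ⟨c, hc, hpos⟩ := exists_weight_pos_of_lt (L := .down (component S b)) hw' (by
        simp only [weight, if_pos, hcomp]; omega)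
      obtain ⟨l₁, rfl⟩ := Multiset.exists_cons_of_mem hc
      simp only [weight] at hpos
      split_ifs at hpos with hcond
      swap
      · omega
      have hac := hba.symm.trans (connected_of_component_eq (hcong.right c (by simp)) hcond)
      obtain ⟨c', a', h⟩ := hS.exists_shift (K := K) hr hs hsn ht hac.symm (by omega) (by omega)
      have := h.sum_right
      exact ih (hcong.trans (.of_pair h.conn_right.2.1 h.conn_left.2.1 hcong.right
          (by rw [mul_comm, h.mk_eq, mul_comm])))
        (hba.trans h.conn_right) (fun k hk => (h.agree_right k hk).trans (hagree k hk))
        (blockSum_le _) (by omega)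

lemma exists_cong_sEquiv (hS : IsSwitchable s t S) (hr : ∀ i, 2 ≤ r i) (hs : 1 ≤ s)
    (hsn : s ≤ n) (ht : 1 ≤ t) {l l' : Multiset (Index r)} (hl : ∀ e ∈ l, e ∈ S)
    (hw : monWeight s t S l = monWeight s t S (b ::ₘ l')) :
    ∃ a l₀, Cong K s t S l (a ::ₘ l₀) ∧ SEquiv s a b := by
  obtain ⟨a, l₀, hcong, hba, htail, hfree⟩ :=
    exists_cong_agree (K := K) hS hr hs ht hl hw Finset.univ
  have hfree' := fun k => hfree k (Finset.mem_univ k)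
  by_cases h1 : s = 1
  · have : a = b := funext fun k => by
      by_cases hk : k.val < t
      · exact hfree' k hk (.inr h1)
      · exact htail k (by omega) (by omega)
    exact ⟨a, l₀, hcong, this ▸ ⟨rfl, fun _ _ => rfl⟩⟩
  · refine exists_cong_sEquiv_of_two_le hS hr (by omega) hsn ht hw hcong hba fun k hk => ?_
    by_cases hkt : k.val < t
    · exact hfree' k hkt (.inl hk)
    · exact htail k (by omega) hk

lemma cong_of_monWeight_eq (hS : IsSwitchable s t S) (hr : ∀ i, 2 ≤ r i) (hs : 1 ≤ s)
    (hsn : s ≤ n) (ht : 1 ≤ t) {l l' : Multiset (Index r)} (hl : ∀ e ∈ l, e ∈ S)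
    (hl' : ∀ e ∈ l', e ∈ S) (hw : monWeight s t S l = monWeight s t S l') :
    Cong K s t S l l' := by
  induction l' using Multiset.induction generalizing l with
  | empty =>
    have h0 : l = 0 := by
      by_contra hne
      obtain ⟨a, ha⟩ := Multiset.exists_mem_of_ne_zero hne
      obtain ⟨l, rfl⟩ := Multiset.exists_cons_of_mem ha
      -- Every factor contributes one to some `rest` label, so only the empty monomial has weight
      -- zero.
      have := congrFun hw (.rest (component S a) (tail s t a))
      rw [monWeight_cons] at this
      simp [weight, monWeight] at this
    subst h0
    exact ⟨hl, hl', rfl⟩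
  | cons b l' ih =>
    obtain ⟨a, l₀, hcong, hab⟩ := exists_cong_sEquiv (K := K) hS hr hs hsn ht hl hw
    have hb := hl' b (by simp)
    have ha : a ∈ S := hcong.right a (by simp)
    have hw' := (hcong.monWeight_eq hS hr hs ht).symm.trans hw
    rw [monWeight_cons, monWeight_cons,
      weight_eq_of_sEquiv hab (hS.connected_of_sEquiv hr hs ht ha hab), add_right_inj] at hw'
    have := (ih (fun e he => hcong.right e (by simp [he])) (fun e he => hl' e (by simp [he]))
      hw').cons hb
    refine ⟨hl, hl', ?_⟩
    rw [hcong.mk_eq, ← this.mk_eq, mon_cons, mon_cons, x_eq_of_sEquiv hab]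

lemma exists_mon_eq_monomial (m : Quotient (sSetoid r s) →₀ ℕ) :
    ∃ l : Multiset (Index r), mon K s l = MvPolynomial.monomial m 1 := by
  induction m using Finsupp.induction_linear with
  | zero => exact ⟨0, by simp [mon]⟩
  | add f g hf hg =>
    obtain ⟨l, hl⟩ := hf
    obtain ⟨l', hl'⟩ := hg
    refine ⟨l + l', ?_⟩
    rw [mon, Multiset.map_add, Multiset.prod_add]
    change mon K s l * mon K s l' = _
    rw [hl, hl', MvPolynomial.monomial_mul, one_mul]
  | single q k =>
    refine ⟨Multiset.replicate k q.out, ?_⟩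
    rw [mon, Multiset.map_replicate, Multiset.prod_replicate, x, Quotient.out_eq,
      MvPolynomial.X_pow_eq_monomial]

open Classical in
/-- A representative modulo `P_S` of the monomials of a given weight. -/
noncomputable def representative (K : Type*) [Field K] (s t : ℕ) (S : Set (Index r))
    (u : Label r → ℕ) : Ring K r s ⧸ P K s t S :=
  if h : ∃ l : Multiset (Index r), (∀ a ∈ l, a ∈ S) ∧ monWeight s t S l = u then
    Ideal.Quotient.mk _ (mon K s h.choose) else 0

lemma ker_toricMap (hS : IsSwitchable s t S) (hr : ∀ i, 2 ≤ r i) (hs : 1 ≤ s)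
    (hsn : s ≤ n) (ht : 1 ≤ t) : RingHom.ker (toricMap K s t S) = P K s t S := by
  refine le_antisymm (fun f hf => ?_) (P_le_ker_toricMap hS hr hs ht)
  -- The quotient map factors `K`-linearly through the toric map, by sending a weight to the class
  -- of any monomial of that weight. Hence the kernel of the toric map is contained in `P K s t S`.
  have key : ((Finsupp.linearCombination K (representative K s t S)).comp
      (AddMonoidAlgebra.coeffLinearEquiv K).toLinearMap).comp (toricMap K s t S).toLinearMap =
      (Ideal.Quotient.mkₐ K (P K s t S)).toLinearMap := by
    refine MvPolynomial.linearMap_ext fun m => LinearMap.ext_ring ?_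
    obtain ⟨l, hl⟩ := exists_mon_eq_monomial (K := K) m
    simp only [LinearMap.comp_apply, ← hl, AlgHom.toLinearMap_apply, Ideal.Quotient.mkₐ_eq_mk,
      LinearEquiv.coe_coe]
    by_cases hlS : ∀ a ∈ l, a ∈ S
    · have hex : ∃ l' : Multiset (Index r), (∀ a ∈ l', a ∈ S) ∧
          monWeight s t S l' = monWeight s t S l := ⟨l, hlS, rfl⟩
      rw [toricMap_mon hS hr hs ht hlS]
      change Finsupp.linearCombination K _ (Finsupp.single _ 1) = _
      rw [Finsupp.linearCombination_single, one_smul, representative, dif_pos hex]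
      exact (cong_of_monWeight_eq hS hr hs hsn ht hex.choose_spec.1 hlS hex.choose_spec.2).mk_eq
    · push Not at hlS
      obtain ⟨a, ha, haS⟩ := hlS
      rw [toricMap_mon_of_notMem hS ha haS, map_zero, map_zero]
      obtain ⟨l, rfl⟩ := Multiset.exists_cons_of_mem ha
      rw [mon_cons]
      exact (Ideal.Quotient.eq_zero_iff_mem.2 (Ideal.mul_mem_right _ _ (x_mem_P haS))).symm
  rw [← Ideal.Quotient.eq_zero_iff_mem]
  have := LinearMap.congr_fun key f
  simp only [LinearMap.comp_apply, AlgHom.toLinearMap_apply, RingHom.mem_ker.1 hf, map_zero] at this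
  exact this.symm

lemma P_isPrime (hS : IsSwitchable s t S) (hr : ∀ i, 2 ≤ r i) (hs : 1 ≤ s)
    (hsn : s ≤ n) (ht : 1 ≤ t) : (P K s t S).IsPrime := by
  rw [← ker_toricMap hS hr hs hsn ht]
  exact RingHom.ker_isPrime _

/-! ### Primes over the slice-minor ideal -/

lemma sliceIdeal_le_P (hS : IsSwitchable s t S) : sliceIdeal K r s t ≤ P K s t S := by
  refine Ideal.span_le.2 ?_
  rintro _ ⟨i, a, b, hi, hab, rfl⟩
  by_cases hne : a i = b i
  · rw [minor, sw_eq_self hne, sw_eq_self hne.symm, sub_self]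
    exact zero_mem _
  obtain ⟨j, hji, hj, hk⟩ := exists_of_hammingDist_eq_two hab hne
  by_cases hS' : a ∈ S ∧ b ∈ S
  · obtain ⟨ha, hb⟩ := hS'
    have hm := hS.sw_mem a ha b hb hab i hi
    refine minor_mem_P hi ((connected_of_forall_ne (i := i) ha hm fun k hk => by simp [hk]).trans
      (connected_of_forall_ne (i := j) hm hb fun k hkj => ?_))
    by_cases hki : k = i
    · subst hki; simp
    · simp [hki, hk k hki hkj]
  · have h1 : x K s a * x K s b ∈ P K s t S := by
      rcases not_and_or.1 hS' with h | h
      · exact Ideal.mul_mem_right _ _ (x_mem_P h)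
      · exact Ideal.mul_mem_left _ _ (x_mem_P h)
    -- Switching is an involution on pairs, so both switches in `S` would force `a` and `b` into
    -- `S`.
    have h2 : sw i a b ∉ S ∨ sw i b a ∉ S := by
      by_contra! hc
      have hd : hammingDist (sw i a b) (sw i b a) = 2 :=
        hammingDist_eq_two_of hji.symm (by simpa using Ne.symm hne) (by simpa [hji] using hj)
          fun k h1 h2 => by simp [h1, hk k h1 h2]
      have h3 := hS.sw_mem _ hc.1 _ hc.2 hd i hi
      have h4 := hS.sw_mem _ hc.2 _ hc.1 (by rw [hammingDist_comm]; exact hd) i hi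
      rw [sw_sw_sw] at h3 h4
      exact hS' ⟨h3, h4⟩
    refine Ideal.sub_mem _ h1 ?_
    rcases h2 with h | h
    · exact Ideal.mul_mem_right _ _ (x_mem_P h)
    · exact Ideal.mul_mem_left _ _ (x_mem_P h)

variable {Q : Ideal (Ring K r s)}

/-- The indices whose variables do not lie in a given ideal. -/
def support (Q : Ideal (Ring K r s)) : Set (Index r) := {a | x K s a ∉ Q}

lemma isSwitchable_support [hQ : Q.IsPrime] (hI : sliceIdeal K r s t ≤ Q) :
    IsSwitchable s t (support Q) where
  sw_mem a ha b hb hab i hi hc := by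
    have h1 : minor K s i a b ∈ Q := hI (Ideal.subset_span ⟨i, a, b, hi, hab, rfl⟩)
    have h2 : x K s a * x K s b ∈ Q :=
      (Submodule.sub_mem_iff_left Q (Ideal.mul_mem_right _ _ hc)).1 h1
    exact (hQ.mem_or_mem h2).elim ha hb
  mem_of_sEquiv a ha b h := by
    have : x K s b ∉ Q := by rw [x_eq_of_sEquiv h]; exact ha
    exact this

lemma update_mul_sub_mem_of_dist_one (hI : sliceIdeal K r s t ≤ Q) (hi : i.val < t)
    (hcd : hammingDist c d = 1) (v w : Fin (r i)) :
    x K s (Function.update c i v) * x K s (Function.update d i w) -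
      x K s (Function.update c i w) * x K s (Function.update d i v) ∈ Q := by
  obtain ⟨j, hj, hk⟩ := exists_of_hammingDist_eq_one hcd
  by_cases hvw : v = w
  · rw [hvw, sub_self]; exact zero_mem _
  by_cases hij : j = i
  · subst hij
    have h : ∀ u, Function.update c j u = Function.update d j u := fun u => by
      funext k
      by_cases hkj : k = j
      · subst hkj; simp
      · simp [hkj, hk k hkj]
    rw [h, h, mul_comm, sub_self]
    exact zero_mem _
  · refine hI (Ideal.subset_span ⟨i, Function.update c i v, Function.update d i w, hi, ?_, ?_⟩)
    · refine hammingDist_eq_two_of (i := i) (j := j) (Ne.symm hij) (by simpa using hvw)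
        (by simpa [hij] using hj) fun k h1 h2 => by simp [h1, hk k h2]
    · simp [minor, sw]

/-- The relation is carried along the path: two consecutive relations combine into the new one times
`x K s (Function.update c i w)`, which can be cancelled because `Q` is prime and that index stays in
the support. -/
lemma update_mul_sub_mem [hQ : Q.IsPrime] (hI : sliceIdeal K r s t ≤ Q) (hi : i.val < t)
    (h : Connected (support Q) a b) {v w : Fin (r i)} (hw : Function.update a i w ∈ support Q) :
    x K s (Function.update a i v) * x K s (Function.update b i w) -
      x K s (Function.update a i w) * x K s (Function.update b i v) ∈ Q := by
  obtain ⟨ha, -, h⟩ := h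
  induction h with
  | refl => rw [mul_comm, sub_self]; exact zero_mem _
  | @tail c d hac hcd ih =>
    have hcw : Function.update c i w ∈ support Q :=
      (isSwitchable_support hI).update_mem hi ⟨ha, hcd.1, hac⟩ hw
    have h1 := update_mul_sub_mem_of_dist_one hI hi hcd.2.2 v w
    refine (hQ.mem_or_mem (?_ : x K s (Function.update c i w) * _ ∈ Q)).resolve_left hcw
    have h2 := Ideal.add_mem _ (Ideal.mul_mem_left _ (x K s (Function.update d i w)) ih)
      (Ideal.mul_mem_left _ (x K s (Function.update a i w)) h1)
    convert h2 using 1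
    ring

lemma P_support_le [Q.IsPrime] (hI : sliceIdeal K r s t ≤ Q) : P K s t (support Q) ≤ Q := by
  refine sup_le (Ideal.span_le.2 ?_) (Ideal.span_le.2 ?_)
  · rintro _ ⟨a, ha, rfl⟩
    exact not_not.1 ha
  · rintro _ ⟨i, a, b, hi, h, rfl⟩
    have h1 := update_mul_sub_mem hI hi h (v := b i) (w := a i) (by simpa using h.1)
    rw [SetLike.mem_coe, ← neg_mem_iff]
    convert h1 using 1
    simp [minor, sw]

lemma subset_of_P_le {T : Set (Index r)} (hS : IsSwitchable s t S) (hr : ∀ i, 2 ≤ r i)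
    (hs : 1 ≤ s) (ht : 1 ≤ t) (h : P K s t T ≤ P K s t S) : S ⊆ T := by
  intro a ha
  by_contra hT
  exact (x_mem_P_iff (K := K) hS hr hs ht).1 (h (x_mem_P hT)) ha

end HankelHypermatrix

/-! ### The minimal primes. -/

open HankelHypermatrix in
theorem mainTheorem7 (K : Type*) [Field K] (n : ℕ) (r : Fin n → ℕ) (hr : ∀ i, 2 ≤ r i)
    (s t : ℕ) (hs : 1 ≤ s) (hsn : s ≤ n) (ht : 1 ≤ t) (htn : t ≤ n) :
    (HankelHypermatrix.sliceIdeal K r s t).minimalPrimes =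
      {Q | ∃ S : Set (HankelHypermatrix.Index r),
        HankelHypermatrix.IsMaximalSwitchable K s t S ∧ Q = HankelHypermatrix.P K s t S} := by
  ext Q
  constructor
  · rintro ⟨⟨hQ, hI⟩, hmin⟩
    have hS := isSwitchable_support hI
    have hPQ := P_support_le hI
    have hQP : Q = P K s t (support Q) :=
      le_antisymm (hmin ⟨P_isPrime hS hr hs hsn ht, sliceIdeal_le_P hS⟩ hPQ) hPQ
    refine ⟨support Q, ⟨hS, fun T hT hST => ⟨fun h => ?_, fun h => ?_⟩⟩, hQP⟩
    -- This half of the incomparability holds for any proper inclusion of switchable sets; only the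
    -- other half uses minimality.
    · exact hST.2 (subset_of_P_le hT hr hs ht h)
    · have h' := hmin ⟨P_isPrime hT hr hs hsn ht, sliceIdeal_le_P hT⟩ (h.trans hPQ)
      exact hST.2 (subset_of_P_le hT hr hs ht (hPQ.trans h'))
  · rintro ⟨S, ⟨hS, hmax⟩, rfl⟩
    refine ⟨⟨P_isPrime hS hr hs hsn ht, sliceIdeal_le_P hS⟩, ?_⟩
    rintro Q ⟨hQ, hI⟩ hQS
    have hT := isSwitchable_support hI
    have hTQ := P_support_le hI
    have hle := hTQ.trans hQS
    rcases (subset_of_P_le hS hr hs ht hle).eq_or_ssubset with heq | hss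
    · rw [heq]; exact hTQ
    · exact absurd hle (hmax _ hT hss).2
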